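/- Let $0<\kappa<1$, let $n\ge 1$ be an integer and let $0=x_0<x_1<\dots<x_{n-1}<x_n=1$. Let $I_1,\dots,I_n$ be pairwise disjoint intervals with $\bigcup_{i=1}^n I_i=[0,1)$ such that $I_i$ has endpoints $x_{i-1}$ and $x_i$; each $I_i$ may be open, closed or half-open. Let $f:[0,1)\to[0,1)$ be a piecewise contraction of $n$ intervals, i.e. an injective map such that $f|_{I_i}$ is $\kappa$-Lipschitz for every $i$ (each $f|_{I_i}$ may be increasing or decreasing; $f$ may, but need not, be discontinuous at $x_1,\dots,x_{n-1}$). A point $p\in[0,1)$ is periodic if $f^k(p)=p$ for some $k\ge 1$, and then $\{f^\ell(p):\ell\ge 0\}$ is called a periodic orbit of $f$. For $x\in[0,1)$ let $\omega(x)$ be the set of all $p\in[0,1]$ for which there are positive integers $n_1<n_2<\cdots$ with $\lim_{\ell\to\infty}f^{n_\ell}(x)=p$. Then $f$ has at most $n$ periodic orbits. Moreover, if $f$ has exactly $n$ periodic orbits, then $f$ is asymptotically periodic: for every $x\in[0,1)$ the set $\omega(x)$ is a periodic orbit of $f$. -/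

import Mathlib

open Set Filter Topology
open scoped NNReal

/-- `I` is one of the four intervals with endpoints `a` and `b`. -/
def IsIntervalWithEndpoints (I : Set ℝ) (a b : ℝ) : Prop :=
  I = Ioo a b ∨ I = Ico a b ∨ I = Ioc a b ∨ I = Icc a b

/-- `f : [0,1) → [0,1)` is a piecewise contraction of `n` intervals: it is injective, and for some
`κ ∈ (0,1)` and some `0 = x₀ < x₁ < ⋯ < xₙ = 1` the interval `[0,1)` is the disjoint union of
intervals `I₁, …, Iₙ`, where `Iᵢ` has endpoints `xᵢ₋₁` and `xᵢ` and `f` is `κ`-Lipschitz on `Iᵢ`.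
(The index `i : Fin n` is the index `i + 1` of the text above. Discontinuity of `f` at `x₁, …, xₙ₋₁` is allowed
but not required.) -/
def IsPiecewiseContraction (n : ℕ) (f : Ico (0 : ℝ) 1 → Ico (0 : ℝ) 1) : Prop :=
  Function.Injective f ∧
    ∃ (κ : ℝ≥0) (x : Fin (n + 1) → ℝ) (I : Fin n → Set ℝ),
      0 < κ ∧ κ < 1 ∧
      StrictMono x ∧ x 0 = 0 ∧ x (Fin.last n) = 1 ∧
      (∀ i : Fin n, IsIntervalWithEndpoints (I i) (x i.castSucc) (x i.succ)) ∧
      Pairwise (fun i j => Disjoint (I i) (I j)) ∧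
      (⋃ i, I i) = Ico (0 : ℝ) 1 ∧
      ∀ i : Fin n, LipschitzOnWith κ f {y | (y : ℝ) ∈ I i}

/-- The forward orbit `{f^ℓ(p) | ℓ ≥ 0}` of `p`. -/
def forwardOrbit {α : Type*} (f : α → α) (p : α) : Set α :=
  {y | ∃ l : ℕ, y = f^[l] p}

/-- The set of periodic orbits of `f`: the forward orbits of its periodic points, where `p` is
periodic if `f^k(p) = p` for some `k ≥ 1`. -/
def periodicOrbits {α : Type*} (f : α → α) : Set (Set α) :=
  {γ | ∃ p ∈ Function.periodicPts f, γ = forwardOrbit f p}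

/-- The set of `ω`-limit points in `[0,1]` of `y ∈ [0,1)` (they may include the point `1`). -/
def omegaLimitSet (f : Ico (0 : ℝ) 1 → Ico (0 : ℝ) 1) (y : Ico (0 : ℝ) 1) : Set ℝ :=
  {p | p ∈ Icc (0 : ℝ) 1 ∧ ∃ φ : ℕ → ℕ, StrictMono φ ∧ (∀ l, 0 < φ l) ∧
    Tendsto (fun l => ((f^[φ l] y : Ico (0 : ℝ) 1) : ℝ)) atTop (𝓝 p)}

/-- `ω(y)` is a periodic orbit of `f` for every `y ∈ [0,1)`. -/
def IsAsymptoticallyPeriodic (f : Ico (0 : ℝ) 1 → Ico (0 : ℝ) 1) : Prop :=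
  ∀ y : Ico (0 : ℝ) 1, ∃ γ ∈ periodicOrbits f, omegaLimitSet f y = Subtype.val '' γ

/-!
For `y ∈ [0, 1)` let `ι y` be the index of the piece containing `y`. It is monotone in `y`, and `f`
contracts distances on each level set of `ι`. The *cut* `i` separates the levels `≤ i` from the
levels `> i`; there are `n - 1` cuts.

*Counting.* Let `P` be a finite union of periodic orbits, and consider the graph (`orbitGraph`) on
these orbits in which two distinct orbits are adjacent if they contain consecutive points `p < q` of
`P` separated by a cut. Two consecutive points of `P` on the same level are moved closer together by
`f`, along their orbits. Hence among the pairs of points of `P` whose orbits are not joined by a path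
in the graph, a closest one would have to be consecutive and separated by a cut, that is, adjacent.
So the graph is connected (`OrbitLabelling.connected`). A cut lies between at most one pair of
consecutive points, so there are at most `n - 1` edges and hence at most `n` vertices
(`OrbitLabelling.card_le`).

*The extremal case.* If there are `n` orbits, the graph is a tree whose edges correspond to the cuts
(`OrbitLabelling.tree_of_card_eq`). Let `y` follow a nearest point `p` of `P`. No point of
`P` lies between the two, and this persists, while both are on the same level, by the intermediate
value theorem and the injectivity of `f`. The distance contracts until a cut separates the iterates of `y`
and `p`; then the iterate of `y` lies in a gap of `P` across this cut and on the level of its other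
end point (`OrbitLabelling.exists_gap_of_level_ne`), which is followed next. This crosses an edge of
the tree. The same edge is not crossed back at the following switch, because the distance to the
point being followed has not increased. A walk in a finite tree that never turns back is a path, so
only finitely many switches occur (`OrbitLabelling.exists_iterate_level_eq`). From then on the
distance from the orbit of `y` to a fixed periodic orbit tends to zero, and `ω(y)` is that orbit
(`omegaLimitSet_eq_of_tendsto_dist`).
-/

/-! ### Contractions on the level sets of a monotone index -/

/-- `f` is a `κ`-contraction on each level set of the monotone function `ι`, which takes values
below `n`. For a piecewise contraction, `ι y` is the index of the piece that contains `y`. -/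
structure ContractsOnLevels (n : ℕ) (κ : ℝ) (f : Ico (0 : ℝ) 1 → Ico (0 : ℝ) 1)
    (ι : Ico (0 : ℝ) 1 → ℕ) : Prop where
  nonneg : 0 ≤ κ
  lt_one : κ < 1
  mono : Monotone ι
  lt : ∀ y, ι y < n
  dist_le : ∀ y z, ι y = ι z → dist (f y) (f z) ≤ κ * dist y z

theorem IsPiecewiseContraction.exists_contractsOnLevels {n : ℕ}
    {f : Ico (0 : ℝ) 1 → Ico (0 : ℝ) 1} (hf : IsPiecewiseContraction n f) :
    ∃ κ ι, ContractsOnLevels n κ f ι := by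
  obtain ⟨-, κ, x, I, -, hκ, hx, -, -, hI, -, hU, hL⟩ := hf
  have hex : ∀ y : Ico (0 : ℝ) 1, ∃ i, (y : ℝ) ∈ I i := fun y => by
    exact mem_iUnion.1 (hU.symm.subset y.2)
  choose c hc using hex
  have hcc : ∀ i, I i ⊆ Icc (x i.castSucc) (x i.succ) := fun i => by
    rcases hI i with h | h | h | h <;> rw [h]
    exacts [Ioo_subset_Icc_self, Ico_subset_Icc_self, Ioc_subset_Icc_self]
  refine ⟨κ, fun y => c y, κ.2, by exact_mod_cast hκ, fun y z hyz => ?_, fun y => (c y).2,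
    fun y z h => ?_⟩
  · rcases hyz.eq_or_lt with rfl | hlt
    · exact le_rfl
    by_contra hlt'
    have h1 : x (c z).succ ≤ x (c y).castSucc :=
      hx.monotone (Fin.le_def.2 (by simpa using hlt'))
    have h2 := (hcc _ (hc z)).2
    have h3 := (hcc _ (hc y)).1
    exact absurd (Subtype.coe_lt_coe.2 hlt) (by linarith)
  · have hz : (z : ℝ) ∈ I (c y) := by rw [Fin.ext h]; exact hc z
    exact (hL (c y)).dist_le_mul y (hc y) z hz

section

variable {n : ℕ} {κ : ℝ} {f : Ico (0 : ℝ) 1 → Ico (0 : ℝ) 1} {ι : Ico (0 : ℝ) 1 → ℕ}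

theorem ContractsOnLevels.eq_of_mem_uIcc (h : ContractsOnLevels n κ f ι) {y z s : Ico (0 : ℝ) 1}
    (hyz : ι y = ι z) (hs : s ∈ uIcc y z) : ι s = ι y := by
  rcases mem_uIcc.1 hs with ⟨h1, h2⟩ | ⟨h1, h2⟩ <;>
    have := h.mono h1 <;> have := h.mono h2 <;> omega

theorem ContractsOnLevels.dist_le_dist (h : ContractsOnLevels n κ f ι) {y z : Ico (0 : ℝ) 1}
    (hyz : ι y = ι z) : dist (f y) (f z) ≤ dist y z :=
  (h.dist_le y z hyz).trans (mul_le_of_le_one_left dist_nonneg h.lt_one.le)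

theorem ContractsOnLevels.dist_iterate_le (h : ContractsOnLevels n κ f ι) {y z : Ico (0 : ℝ) 1}
    (m : ℕ) (hyz : ∀ k < m, ι (f^[k] y) = ι (f^[k] z)) :
    dist (f^[m] y) (f^[m] z) ≤ κ ^ m * dist y z := by
  induction m with
  | zero => simp
  | succ m ih =>
    rw [Function.iterate_succ_apply', Function.iterate_succ_apply', pow_succ', mul_assoc]
    exact (h.dist_le _ _ (hyz m m.lt_succ_self)).trans
      (mul_le_mul_of_nonneg_left (ih fun k hk => hyz k (hk.trans m.lt_succ_self)) h.nonneg)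

/-- By the intermediate value theorem, `f` carries a segment inside a level set that meets no point
of the backward invariant set `P` to a segment that meets no point of `P`. -/
theorem ContractsOnLevels.forall_notMem_uIoo_map (h : ContractsOnLevels n κ f ι)
    {P : Set (Ico (0 : ℝ) 1)} (hP : ∀ y, f y ∈ P → y ∈ P) {y z : Ico (0 : ℝ) 1}
    (hyz : ι y = ι z) (hfree : ∀ r ∈ P, r ∉ uIoo y z) : ∀ r ∈ P, r ∉ uIoo (f y) (f z) := by
  intro r hr hr'
  have hlip : LipschitzOnWith ⟨κ, h.nonneg⟩ f (uIcc y z) :=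
    LipschitzOnWith.of_dist_le_mul fun s hs t ht =>
      h.dist_le s t ((h.eq_of_mem_uIcc hyz hs).trans (h.eq_of_mem_uIcc hyz ht).symm)
  have : Inhabited (Ico (0 : ℝ) 1) := ⟨y⟩
  obtain ⟨s, hs, rfl⟩ := intermediate_value_uIcc hlip.continuousOn (uIoo_subset_uIcc_self hr')
  have hsy : s ≠ y := by rintro rfl; exact left_notMem_uIoo hr'
  have hsz : s ≠ z := by rintro rfl; exact right_notMem_uIoo hr'
  refine hfree s (hP s hr) ?_
  rcases mem_uIcc.1 hs with ⟨h1, h2⟩ | ⟨h1, h2⟩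
  · exact mem_uIoo_of_lt (h1.lt_of_ne' hsy) (h2.lt_of_ne hsz)
  · exact mem_uIoo_of_gt (h1.lt_of_ne' hsz) (h2.lt_of_ne hsy)

/-! ### Gaps between periodic points and the graph of orbits -/

/-- `p < q` are consecutive points of `P`, and the cut between the levels `≤ i` and the levels `> i`
of `ι` lies between them. -/
structure IsGap (ι : Ico (0 : ℝ) 1 → ℕ) (P : Set (Ico (0 : ℝ) 1)) (i : ℕ)
    (p q : Ico (0 : ℝ) 1) : Prop where
  left_mem : p ∈ P
  right_mem : q ∈ P
  left_le : ι p ≤ i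
  lt_right : i < ι q
  free : ∀ r ∈ P, r ∉ Ioo p q

theorem IsGap.lt {P : Set (Ico (0 : ℝ) 1)} {i : ℕ} {p q : Ico (0 : ℝ) 1} (hι : Monotone ι)
    (h : IsGap ι P i p q) : p < q :=
  hι.reflect_lt (h.left_le.trans_lt h.lt_right)

theorem IsGap.eq {P : Set (Ico (0 : ℝ) 1)} {i : ℕ} {p q p' q' : Ico (0 : ℝ) 1}
    (hι : Monotone ι) (h : IsGap ι P i p q) (h' : IsGap ι P i p' q') : p = p' ∧ q = q' := by
  have h1 : p < q' := hι.reflect_lt (h.left_le.trans_lt h'.lt_right)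
  have h2 : p' < q := hι.reflect_lt (h'.left_le.trans_lt h.lt_right)
  constructor
  · rcases lt_trichotomy p p' with hlt | heq | hlt
    · exact absurd ⟨hlt, h2⟩ (h.free p' h'.left_mem)
    · exact heq
    · exact absurd ⟨hlt, h1⟩ (h'.free p h.left_mem)
  · rcases lt_trichotomy q q' with hlt | heq | hlt
    · exact absurd ⟨h2, hlt⟩ (h'.free q h.right_mem)
    · exact heq
    · exact absurd ⟨h1, hlt⟩ (h.free q' h'.right_mem)

/-- A finite, forward and backward `f`-invariant set `P` with a labelling `v` of its points by `V`
that is constant on orbits and onto: `P` is a finite union of periodic orbits, and `V` is the set of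
these orbits. The values of `v` outside `P` play no role. -/
structure OrbitLabelling (f : Ico (0 : ℝ) 1 → Ico (0 : ℝ) 1) (P : Set (Ico (0 : ℝ) 1))
    {V : Type*} (v : Ico (0 : ℝ) 1 → V) : Prop where
  finite : P.Finite
  map_mem : ∀ y ∈ P, f y ∈ P
  mem_of_map_mem : ∀ y, f y ∈ P → y ∈ P
  label_map : ∀ y ∈ P, v (f y) = v y
  exists_label_eq : ∀ γ, ∃ p ∈ P, v p = γ

/-- Two orbits are adjacent if they are distinct and some point of the one and some point of the
other bound a gap across a cut. -/
def orbitGraph (ι : Ico (0 : ℝ) 1 → ℕ) (P : Set (Ico (0 : ℝ) 1)) {V : Type*}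
    (v : Ico (0 : ℝ) 1 → V) : SimpleGraph V where
  Adj γ γ' := γ ≠ γ' ∧ ∃ i p q, IsGap ι P i p q ∧ s(v p, v q) = s(γ, γ')
  symm := ⟨fun _ _ ⟨h, i, p, q, hg, he⟩ => ⟨h.symm, i, p, q, hg, he.trans Sym2.eq_swap⟩⟩
  loopless := ⟨fun _ h => h.1 rfl⟩

section

variable {P : Set (Ico (0 : ℝ) 1)} {V : Type*} {v : Ico (0 : ℝ) 1 → V}

theorem OrbitLabelling.iterate_mem (hP : OrbitLabelling f P v) {p : Ico (0 : ℝ) 1} (hp : p ∈ P)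
    (k : ℕ) : f^[k] p ∈ P ∧ v (f^[k] p) = v p := by
  induction k with
  | zero => exact ⟨hp, rfl⟩
  | succ k ih =>
    rw [Function.iterate_succ_apply']
    exact ⟨hP.map_mem _ ih.1, (hP.label_map _ ih.1).trans ih.2⟩

/-- Take a closest pair of points of `P` whose orbits are not joined by a path. No point of `P` lies
between them, and they lie on different levels, since `f` would otherwise bring them closer. So they
bound a gap across a cut, and their orbits are adjacent. -/
theorem OrbitLabelling.connected [Nonempty V] (h : ContractsOnLevels n κ f ι)
    (hP : OrbitLabelling f P v) : (orbitGraph ι P v).Connected := by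
  have key : ∀ p ∈ P, ∀ q ∈ P, (orbitGraph ι P v).Reachable (v p) (v q) := by
    by_contra! hcon
    obtain ⟨p₀, hp₀, q₀, hq₀, hr₀⟩ := hcon
    let S : Set (Ico (0 : ℝ) 1 × Ico (0 : ℝ) 1) :=
      {a ∈ P ×ˢ P | ¬ (orbitGraph ι P v).Reachable (v a.1) (v a.2)}
    have hS : S.Finite := (hP.finite.prod hP.finite).subset (sep_subset _ _)
    obtain ⟨⟨p, q⟩, ⟨⟨hp, hq⟩, hr⟩, hmin⟩ := S.exists_min_image (fun a => dist a.1 a.2) hS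
      ⟨(p₀, q₀), ⟨hp₀, hq₀⟩, hr₀⟩
    replace hmin : ∀ a ∈ P, ∀ b ∈ P, dist a b < dist p q →
        (orbitGraph ι P v).Reachable (v a) (v b) := fun a ha b hb hlt => by
      by_contra hab
      exact absurd (hmin (a, b) ⟨⟨ha, hb⟩, hab⟩) (not_le.2 hlt)
    have hpq : p ≠ q := by
      rintro rfl
      exact hr .rfl
    have hfree : ∀ r ∈ P, r ∉ uIoo p q := by
      intro r hrP hrm
      have hr1 : dist p r < dist p q ∧ dist r q < dist p q := by
        simp only [Subtype.dist_eq, Real.dist_eq]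
        rcases hpq.lt_or_gt with hlt | hlt
        · rw [uIoo_of_lt hlt, mem_Ioo, ← Subtype.coe_lt_coe, ← Subtype.coe_lt_coe] at hrm
          rw [← Subtype.coe_lt_coe] at hlt
          rw [abs_of_neg (by linarith), abs_of_neg (by linarith), abs_of_neg (by linarith)]
          constructor <;> linarith
        · rw [uIoo_of_gt hlt, mem_Ioo, ← Subtype.coe_lt_coe, ← Subtype.coe_lt_coe] at hrm
          rw [← Subtype.coe_lt_coe] at hlt
          rw [abs_of_pos (by linarith), abs_of_pos (by linarith), abs_of_pos (by linarith)]
          constructor <;> linarith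
      exact hr ((hmin p hp r hrP hr1.1).trans (hmin r hrP q hq hr1.2))
    have hι : ι p ≠ ι q := by
      intro heq
      have hlt : dist (f p) (f q) < dist p q :=
        (h.dist_le p q heq).trans_lt (mul_lt_of_lt_one_left (dist_pos.2 hpq) h.lt_one)
      have := hmin _ (hP.map_mem p hp) _ (hP.map_mem q hq) hlt
      rw [hP.label_map p hp, hP.label_map q hq] at this
      exact hr this
    have hv : v p ≠ v q := fun he => hr (he ▸ .rfl)
    refine hr (SimpleGraph.Adj.reachable ⟨hv, ?_⟩)
    rcases hι.lt_or_gt with hlt | hlt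
    · rw [uIoo_of_lt (h.mono.reflect_lt hlt)] at hfree
      exact ⟨ι p, p, q, ⟨hp, hq, le_rfl, hlt, hfree⟩, rfl⟩
    · rw [uIoo_of_gt (h.mono.reflect_lt hlt)] at hfree
      exact ⟨ι q, q, p, ⟨hq, hp, le_rfl, hlt, hfree⟩, Sym2.eq_swap⟩
  refine ⟨fun γ γ' => ?_⟩
  obtain ⟨p, hp, rfl⟩ := hP.exists_label_eq γ
  obtain ⟨q, hq, rfl⟩ := hP.exists_label_eq γ'
  exact key p hp q hq

/-- Each edge of the graph of orbits comes from a gap across one of the `n - 1` cuts, and distinct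
edges come from distinct cuts. -/
theorem exists_injective_cut (h : ContractsOnLevels n κ f ι) :
    ∃ c : (orbitGraph ι P v).edgeSet → Fin (n - 1), Function.Injective c ∧
      ∀ e, ∃ p q, IsGap ι P (c e) p q ∧ s(v p, v q) = (e : Sym2 V) := by
  have hex : ∀ e : (orbitGraph ι P v).edgeSet, ∃ i : Fin (n - 1), ∃ p q,
      IsGap ι P i p q ∧ s(v p, v q) = (e : Sym2 V) := by
    rintro ⟨e, he⟩
    induction e with
    | h γ γ' =>
      obtain ⟨-, i, p, q, hg, he⟩ := he
      have := h.lt q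
      have := hg.lt_right
      exact ⟨⟨i, by omega⟩, p, q, hg, he⟩
  choose c hc using hex
  refine ⟨c, fun e e' hee => ?_, hc⟩
  obtain ⟨p, q, hg, he⟩ := hc e
  obtain ⟨p', q', hg', he'⟩ := hc e'
  rw [hee] at hg
  obtain ⟨rfl, rfl⟩ := hg.eq h.mono hg'
  exact Subtype.ext (he.symm.trans he')

theorem card_edgeSet_orbitGraph_le (h : ContractsOnLevels n κ f ι) :
    Nat.card (orbitGraph ι P v).edgeSet ≤ n - 1 := by
  obtain ⟨c, hc, -⟩ := exists_injective_cut (P := P) (v := v) h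
  simpa using Nat.card_le_card_of_injective c hc

theorem OrbitLabelling.card_le [Nonempty V] (h : ContractsOnLevels n κ f ι)
    (hP : OrbitLabelling f P v) : Nat.card V ≤ n := by
  have h1 := (hP.connected h).card_vert_le_card_edgeSet_add_one
  have h2 := card_edgeSet_orbitGraph_le (P := P) (v := v) h
  obtain ⟨p, -, -⟩ := hP.exists_label_eq (Classical.arbitrary V)
  have := h.lt p
  omega

/-- Extremal case: with as many orbits as levels, the graph of orbits is a tree whose edges
correspond to the cuts. So each cut lies in a gap between two distinct orbits, and the unordered pair
of orbits determines the cut. -/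
theorem OrbitLabelling.tree_of_card_eq [Nonempty V] [Finite V] (h : ContractsOnLevels n κ f ι)
    (hP : OrbitLabelling f P v) (hV : Nat.card V = n) :
    (orbitGraph ι P v).IsTree ∧
      (∀ i, i + 1 < n → ∃ p q, IsGap ι P i p q ∧ v p ≠ v q) ∧
      ∀ i j p q p' q', IsGap ι P i p q → IsGap ι P j p' q' →
        s(v p, v q) = s(v p', v q') → i = j := by
  have h1 := (hP.connected h).card_vert_le_card_edgeSet_add_one
  have h2 := card_edgeSet_orbitGraph_le (P := P) (v := v) h
  have hn : 0 < Nat.card V := Nat.card_pos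
  have hcard : Nat.card (orbitGraph ι P v).edgeSet = n - 1 := by omega
  obtain ⟨c, hc, hcg⟩ := exists_injective_cut (P := P) (v := v) h
  have hsurj : Function.Surjective c :=
    ((Nat.bijective_iff_injective_and_card c).2 ⟨hc, by simpa using hcard⟩).2
  have hedge : ∀ i p q, IsGap ι P i p q → ∃ e, (c e : ℕ) = i ∧ s(v p, v q) = (e : Sym2 V) := by
    intro i p q hg
    have h3 := h.lt q
    have h4 := hg.lt_right
    obtain ⟨e, he⟩ := hsurj ⟨i, by omega⟩
    obtain ⟨p', q', hg', he'⟩ := hcg e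
    rw [he] at hg'
    obtain ⟨rfl, rfl⟩ := hg.eq h.mono hg'
    exact ⟨e, by rw [he], he'⟩
  refine ⟨SimpleGraph.isTree_iff_connected_and_card.2 ⟨hP.connected h, by omega⟩, ?_, ?_⟩
  · intro i hi
    obtain ⟨e, he⟩ := hsurj ⟨i, by omega⟩
    obtain ⟨p, q, hg, he'⟩ := hcg e
    refine ⟨p, q, by rwa [he] at hg, fun hv => ?_⟩
    have := e.2
    rw [← he', hv] at this
    exact this.1 rfl
  · intro i j p q p' q' hg hg' heq
    obtain ⟨e, rfl, he⟩ := hedge i p q hg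
    obtain ⟨e', rfl, he'⟩ := hedge j p' q' hg'
    rw [Subtype.ext (he.symm.trans (heq.trans he'))]

end

/-! ### Following the nearest periodic point in the extremal case -/

section

variable {P : Set (Ico (0 : ℝ) 1)} {V : Type*} {v : Ico (0 : ℝ) 1 → V}

theorem OrbitLabelling.exists_nearest [Nonempty V] (hP : OrbitLabelling f P v)
    (y : Ico (0 : ℝ) 1) : ∃ p ∈ P, ∀ r ∈ P, r ∉ uIoo p y := by
  obtain ⟨p₀, hp₀, -⟩ := hP.exists_label_eq (Classical.arbitrary V)
  obtain ⟨p, hp, hmin⟩ := P.exists_min_image (fun p => dist p y) hP.finite ⟨p₀, hp₀⟩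
  refine ⟨p, hp, fun r hr hrm => ?_⟩
  have hle := hmin r hr
  simp only [Subtype.dist_eq, Real.dist_eq] at hle
  rcases lt_trichotomy p y with hlt | rfl | hlt
  · rw [uIoo_of_lt hlt, mem_Ioo, ← Subtype.coe_lt_coe, ← Subtype.coe_lt_coe] at hrm
    rw [abs_of_neg (by linarith), abs_of_neg (by linarith)] at hle
    linarith
  · simp at hrm
  · rw [uIoo_of_gt hlt, mem_Ioo, ← Subtype.coe_lt_coe, ← Subtype.coe_lt_coe] at hrm
    rw [abs_of_pos (by linarith), abs_of_pos (by linarith)] at hle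
    linarith

/-- In the extremal case, suppose that no point of `P` lies between `p ∈ P` and `y`, but `p` and `y`
are on different levels. Then `y` lies in a gap with end point `p`, on the level of the other end
point. -/
theorem OrbitLabelling.exists_gap_of_level_ne [Nonempty V] [Finite V]
    (h : ContractsOnLevels n κ f ι) (hP : OrbitLabelling f P v) (hV : Nat.card V = n)
    {p y : Ico (0 : ℝ) 1} (hp : p ∈ P) (hfree : ∀ r ∈ P, r ∉ uIoo p y) (hne : ι p ≠ ι y) :
    ∃ i q, (IsGap ι P i p q ∨ IsGap ι P i q p) ∧ v p ≠ v q ∧ ι q = ι y ∧ y ∈ uIcc p q := by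
  obtain ⟨-, hA, hB⟩ := hP.tree_of_card_eq h hV
  rcases hne.lt_or_gt with hlt | hlt
  · have hpy := h.mono.reflect_lt hlt
    rw [uIoo_of_lt hpy] at hfree
    obtain ⟨a, q, hg, hv⟩ := hA (ι p) (by have := h.lt y; omega)
    have hpq : p < q := h.mono.reflect_lt hg.lt_right
    have hyq : y ≤ q := not_lt.1 fun hqy => hfree q hg.right_mem ⟨hpq, hqy⟩
    have hgp : IsGap ι P (ι p) p q := by
      refine ⟨hp, hg.right_mem, le_rfl, hg.lt_right, fun r hr hrm => ?_⟩
      by_cases hry : r < y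
      · exact hfree r hr ⟨hrm.1, hry⟩
      · have h1 := h.mono (not_lt.1 hry)
        exact hg.free r hr ⟨h.mono.reflect_lt (hg.left_le.trans_lt (hlt.trans_le h1)), hrm.2⟩
    obtain ⟨rfl, -⟩ := hg.eq h.mono hgp
    refine ⟨ι a, q, .inl hgp, hv, ?_, mem_uIcc.2 (.inl ⟨hpy.le, hyq⟩)⟩
    by_contra hqy
    have hle := h.mono hyq
    have := hB _ (ι y) _ _ _ _ hgp ⟨hp, hg.right_mem, hlt.le, by omega, hgp.free⟩ rfl
    omega
  · have hpy := h.mono.reflect_lt hlt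
    rw [uIoo_of_gt hpy] at hfree
    have hlp := h.lt p
    obtain ⟨q, a, hg, hv⟩ := hA (ι p - 1) (by omega)
    have hl := hg.left_le
    have hr := hg.lt_right
    have hpq : q < p := h.mono.reflect_lt (by omega)
    have hyq : q ≤ y := not_lt.1 fun hqy => hfree q hg.left_mem ⟨hqy, hpq⟩
    have hgp : IsGap ι P (ι p - 1) q p := by
      refine ⟨hg.left_mem, hp, hl, by omega, fun r hr hrm => ?_⟩
      by_cases hry : y < r
      · exact hfree r hr ⟨hry, hrm.2⟩
      · have h1 := h.mono (not_lt.1 hry)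
        exact hg.free r hr ⟨hrm.1, h.mono.reflect_lt (by omega)⟩
    obtain ⟨-, rfl⟩ := hg.eq h.mono hgp
    refine ⟨ι a - 1, q, .inr hgp, hv.symm, ?_, mem_uIcc.2 (.inr ⟨hyq, hpy.le⟩)⟩
    by_contra hqy
    have hle := h.mono hyq
    have := hB _ (ι q) _ _ _ _ hgp ⟨hg.left_mem, hp, le_rfl, by omega, hgp.free⟩ rfl
    omega

/-- A point `y` on the level of the end point `q` of a gap is closer to `q` than any point `z` on
the level of the other end point `p`. -/
theorem dist_lt_dist_of_gap (hι : Monotone ι) {i : ℕ} {p q y z : Ico (0 : ℝ) 1}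
    (hg : IsGap ι P i p q ∨ IsGap ι P i q p) (hy : y ∈ uIcc p q) (hyq : ι y = ι q)
    (hzp : ι z = ι p) : dist y q < dist z q := by
  simp only [Subtype.dist_eq, Real.dist_eq]
  rcases hg with hg | hg
  · have hpq := hg.lt hι
    rw [uIcc_of_le hpq.le, mem_Icc, ← Subtype.coe_le_coe, ← Subtype.coe_le_coe] at hy
    have hzy : (z : ℝ) < y := Subtype.coe_lt_coe.2 <| hι.reflect_lt <| by
      rw [hzp, hyq]; exact hg.left_le.trans_lt hg.lt_right
    rw [abs_of_nonpos (by linarith), abs_of_nonpos (by linarith)]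
    linarith
  · have hpq := hg.lt hι
    rw [uIcc_of_ge hpq.le, mem_Icc, ← Subtype.coe_le_coe, ← Subtype.coe_le_coe] at hy
    have hzy : (y : ℝ) < z := Subtype.coe_lt_coe.2 <| hι.reflect_lt <| by
      rw [hzp, hyq]; exact hg.left_le.trans_lt hg.lt_right
    rw [abs_of_nonneg (by linarith), abs_of_nonneg (by linarith)]
    linarith

/-- In the extremal case every orbit eventually visits the same levels as a periodic orbit.

Follow a nearest point of `P` along the iterates, and switch to another point of `P` when a cut
separates the two. A switch crosses a gap, hence an edge of the tree of
orbits, and that edge is not crossed back at the next switch, since the distance to the periodic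
point followed does not increase meanwhile. So the edges crossed form a path in a finite tree, and
the number of switches is bounded. -/
theorem OrbitLabelling.exists_iterate_level_eq [Nonempty V] [Finite V]
    (h : ContractsOnLevels n κ f ι) (hP : OrbitLabelling f P v) (hV : Nat.card V = n)
    (y : Ico (0 : ℝ) 1) :
    ∃ m, ∃ p ∈ P, ∀ k, ι (f^[k] p) = ι (f^[k] (f^[m] y)) := by
  classical
  obtain ⟨htree, -, hB⟩ := hP.tree_of_card_eq h hV
  by_contra! hcon
  obtain ⟨p₀, hp₀, hf₀⟩ := hP.exists_nearest y
  -- The last clause says that, as long as the distance has not increased, the next switch cannot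
  -- go back to the last but one vertex of the path.
  have key : ∀ l : ℕ, ∃ m, ∃ q ∈ P, ∃ w : (orbitGraph ι P v).Walk (v p₀) (v q),
      w.IsPath ∧ w.length = l ∧ (∀ r ∈ P, r ∉ uIoo q (f^[m] y)) ∧
      ∀ i, ∀ q' ∈ P, ∀ r z, v q' = v q → (IsGap ι P i q' r ∨ IsGap ι P i r q') → v q' ≠ v r →
        ι r = ι z → dist q' z ≤ dist q (f^[m] y) → v r ≠ w.penultimate := by
    intro l
    induction l with
    | zero =>
      exact ⟨0, p₀, hp₀, .nil, by simp, rfl, hf₀,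
        fun i q' _ r z hq' _ hne _ _ hr => hne (hq'.trans hr.symm)⟩
    | succ l ih =>
      obtain ⟨m, q, hq, w, hw, hwl, hfree, hback⟩ := ih
      set z := f^[m] y
      -- `k` is the first time at which a cut separates the iterates of `q` and `z`.
      have hex := hcon m q hq
      let k := Nat.find hex
      have hk : ι (f^[k] q) ≠ ι (f^[k] z) := Nat.find_spec hex
      have hk' : ∀ j < k, ι (f^[j] q) = ι (f^[j] z) := fun j hj => not_not.1 (Nat.find_min hex hj)
      have hfreek : ∀ j ≤ k, (∀ r ∈ P, r ∉ uIoo (f^[j] q) (f^[j] z)) ∧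
          dist (f^[j] q) (f^[j] z) ≤ dist q z := by
        intro j
        induction j with
        | zero => exact fun _ => ⟨hfree, le_rfl⟩
        | succ j ihj =>
          intro hj
          obtain ⟨h1, h2⟩ := ihj (by omega)
          rw [Function.iterate_succ_apply', Function.iterate_succ_apply']
          exact ⟨h.forall_notMem_uIoo_map hP.mem_of_map_mem (hk' j hj) h1,
            (h.dist_le_dist (hk' j hj)).trans h2⟩
      obtain ⟨hf1, hd1⟩ := hfreek k le_rfl
      obtain ⟨hqk, hvk⟩ := hP.iterate_mem hq k
      obtain ⟨i, r, hg, hv, hrz, hmem⟩ := hP.exists_gap_of_level_ne h hV hqk hf1 hk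
      have hnew := hback i _ hqk r _ hvk hg hv hrz hd1
      have hadj : (orbitGraph ι P v).Adj (v q) (v r) := by
        rw [← hvk]
        rcases hg with hg | hg
        · exact ⟨hv, i, _, _, hg, rfl⟩
        · exact ⟨hv, i, _, _, hg, Sym2.eq_swap⟩
      have hr : r ∈ P := by
        rcases hg with hg | hg
        exacts [hg.right_mem, hg.left_mem]
      have hiter : f^[k + m] y = f^[k] z := Function.iterate_add_apply f k m y
      refine ⟨k + m, r, hr, w.concat hadj, hw.concat (fun hs => hnew ?_) hadj, by simp [hwl],
        ?_, ?_⟩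
      · exact htree.isAcyclic.eq_penultimate_of_adj_end hw hadj hs
      · rw [hiter]
        intro s hs hsm
        rcases hg with hg | hg
        · have hlt := hg.lt h.mono
          rw [uIcc_of_le hlt.le] at hmem
          rw [uIoo_of_ge hmem.2] at hsm
          exact hg.free s hs ⟨hmem.1.trans_lt hsm.1, hsm.2⟩
        · have hlt := hg.lt h.mono
          rw [uIcc_of_ge hlt.le] at hmem
          rw [uIoo_of_le hmem.1] at hsm
          exact hg.free s hs ⟨hsm.1, hsm.2.trans_le hmem.2⟩
      · rw [hiter]
        intro j q' hq' s t hq'v hg' hv' hst hd hsv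
        rw [SimpleGraph.Walk.penultimate_concat] at hsv
        rw [← hvk] at hsv
        -- Crossing back would use the same cut, hence the same gap.
        have hback : s = f^[k] q ∧ q' = r := by
          rcases hg with hg | hg <;> rcases hg' with hg' | hg' <;>
            obtain rfl := hB _ _ _ _ _ _ hg hg' (by simp [hq'v, hsv]) <;>
            obtain ⟨h1, h2⟩ := hg.eq h.mono hg'
          · exact absurd (h1 ▸ hq'v) hv
          · exact ⟨h1.symm, h2.symm⟩
          · exact ⟨h2.symm, h1.symm⟩
          · exact absurd (h2 ▸ hq'v) hv
        obtain ⟨rfl, rfl⟩ := hback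
        have hlt := dist_lt_dist_of_gap h.mono hg hmem hrz.symm hst.symm
        rw [dist_comm, dist_comm t] at hlt
        exact hlt.not_ge hd
  obtain ⟨m, q, -, w, hw, hwl, -⟩ := key (Nat.card V)
  have := Fintype.ofFinite V
  have := hw.length_lt
  rw [hwl, Nat.card_eq_fintype_card] at this
  exact lt_irrefl _ this

end

/-! ### The ω-limit set of a point that follows a periodic orbit -/

theorem ContractsOnLevels.tendsto_dist_iterate (h : ContractsOnLevels n κ f ι)
    {p z : Ico (0 : ℝ) 1} (hpz : ∀ k, ι (f^[k] p) = ι (f^[k] z)) :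
    Tendsto (fun k => dist (f^[k] p) (f^[k] z)) atTop (𝓝 0) := by
  have h1 : Tendsto (fun k => κ ^ k * dist p z) atTop (𝓝 0) := by
    simpa using (tendsto_pow_atTop_nhds_zero_of_lt_one h.nonneg h.lt_one).mul_const (dist p z)
  exact squeeze_zero (fun _ => dist_nonneg) (fun k => h.dist_iterate_le k fun j _ => hpz j) h1

theorem finite_forwardOrbit {α : Type*} {f : α → α} {p : α} (hp : p ∈ Function.periodicPts f) :
    (forwardOrbit f p).Finite := by
  obtain ⟨k, hk, hpk⟩ := hp
  refine ((finite_lt_nat k).image fun l => f^[l] p).subset ?_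
  rintro _ ⟨l, rfl⟩
  exact ⟨l % k, Nat.mod_lt _ hk, hpk.iterate_mod_apply l⟩

theorem omegaLimitSet_eq_of_tendsto_dist {m : ℕ} {p y : Ico (0 : ℝ) 1}
    (hp : p ∈ Function.periodicPts f)
    (hd : Tendsto (fun k => dist (f^[k] p) (f^[k] (f^[m] y))) atTop (𝓝 0)) :
    omegaLimitSet f y = Subtype.val '' forwardOrbit f p := by
  ext a
  constructor
  · rintro ⟨-, φ, hφ, -, hlim⟩
    have hsub : Tendsto (fun l => φ (l + m) - m) atTop atTop :=
      tendsto_atTop_mono (fun l => Nat.le_sub_of_add_le (hφ.id_le (l + m))) tendsto_id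
    have hd' := hd.comp hsub
    have hlim' := (tendsto_add_atTop_iff_nat m).2 hlim
    refine ((finite_forwardOrbit hp).image Subtype.val).isClosed.mem_of_tendsto
      (f := fun l => ((f^[φ (l + m) - m] p : Ico (0 : ℝ) 1) : ℝ)) (b := atTop) ?_
      (Eventually.of_forall fun l => ⟨_, ⟨_, rfl⟩, rfl⟩)
    refine hlim'.congr_dist (hd'.congr fun l => ?_)
    have hle : m ≤ φ (l + m) := (Nat.le_add_left m l).trans (hφ.id_le (l + m))
    simp only [Function.comp_apply]
    rw [← Function.iterate_add_apply, Nat.sub_add_cancel hle, dist_comm]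
    rfl
  · rintro ⟨_, ⟨s, rfl⟩, rfl⟩
    obtain ⟨k, hk, hpk⟩ := hp
    refine ⟨⟨(f^[s] p).2.1, (f^[s] p).2.2.le⟩, fun l => s + (l + 1) * k + m,
      fun l l' hl => ?_, fun l => ?_, ?_⟩
    · have := Nat.mul_lt_mul_of_pos_right (Nat.succ_lt_succ hl) hk
      simpa using this
    · have : 0 < (l + 1) * k := Nat.mul_pos l.succ_pos hk
      show 0 < s + (l + 1) * k + m
      omega
    · have hsub : Tendsto (fun l => s + (l + 1) * k) atTop atTop :=
        tendsto_atTop_mono (fun l => (l.le_succ.trans (Nat.le_mul_of_pos_right _ hk)).trans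
          (Nat.le_add_left _ _)) tendsto_id
      refine (tendsto_const_nhds (x := ((f^[s] p : Ico (0 : ℝ) 1) : ℝ))).congr_dist
        ((hd.comp hsub).congr fun l => ?_)
      simp only [Function.comp_apply]
      have hper : f^[(l + 1) * k] p = p := (hpk.const_mul (l + 1)).eq
      rw [← Function.iterate_add_apply, Function.iterate_add_apply f s _ p, hper]
      rfl

/-! ### Labelling periodic points by their orbits -/

theorem forwardOrbit_map_eq {α : Type*} {f : α → α} {p : α} (hp : p ∈ Function.periodicPts f) :
    forwardOrbit f (f p) = forwardOrbit f p := by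
  obtain ⟨k, hk, hpk⟩ := hp
  ext y
  constructor
  · rintro ⟨l, rfl⟩
    exact ⟨l + 1, rfl⟩
  · rintro ⟨l, rfl⟩
    refine ⟨l + (k - 1), ?_⟩
    rw [← Function.iterate_succ_apply, Nat.succ_eq_add_one, add_assoc, Nat.sub_add_cancel hk,
      Function.iterate_add_apply, hpk.eq]

theorem exists_orbitLabelling (hf : Function.Injective f) {T : Set (Set (Ico (0 : ℝ) 1))}
    (hT : T ⊆ periodicOrbits f) (hfin : T.Finite) [Nonempty T] :
    ∃ (P : Set (Ico (0 : ℝ) 1)) (v : Ico (0 : ℝ) 1 → T),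
      P ⊆ Function.periodicPts f ∧ OrbitLabelling f P v := by
  classical
  let v : Ico (0 : ℝ) 1 → T := fun y =>
    if hy : forwardOrbit f y ∈ T then ⟨_, hy⟩ else Classical.arbitrary T
  have hv : ∀ y, forwardOrbit f y ∈ T → (v y : Set (Ico (0 : ℝ) 1)) = forwardOrbit f y :=
    fun y hy => by simp only [v, dif_pos hy]
  refine ⟨{y ∈ Function.periodicPts f | forwardOrbit f y ∈ T}, v, sep_subset _ _,
    ?_, ?_, ?_, ?_, ?_⟩
  · refine (hfin.sUnion fun γ hγ => ?_).subset fun y hy => ⟨_, hy.2, 0, rfl⟩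
    obtain ⟨p, hp, rfl⟩ := hT hγ
    exact finite_forwardOrbit hp
  · rintro y ⟨hy, hyT⟩
    refine ⟨?_, by rwa [forwardOrbit_map_eq hy]⟩
    obtain ⟨k, hk, hyk⟩ := hy
    exact ⟨k, hk, hyk.map (Function.Commute.refl f)⟩
  · rintro y ⟨⟨k, hk, hyk⟩, hyT⟩
    have hy : y ∈ Function.periodicPts f := by
      refine ⟨k, hk, hf ?_⟩
      rw [← Function.iterate_succ_apply' f, Function.iterate_succ_apply]
      exact hyk
    exact ⟨hy, by rwa [forwardOrbit_map_eq hy] at hyT⟩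
  · rintro y ⟨hy, hyT⟩
    have hy' := forwardOrbit_map_eq hy
    exact Subtype.ext (by rw [hv y hyT, hv _ (by rwa [hy']), hy'])
  · rintro ⟨γ, hγ⟩
    obtain ⟨p, hp, rfl⟩ := hT hγ
    exact ⟨p, ⟨hp, hγ⟩, Subtype.ext (hv p hγ)⟩

theorem encard_periodicOrbits_le (hf : Function.Injective f) (h : ContractsOnLevels n κ f ι) :
    (periodicOrbits f).encard ≤ n := by
  by_contra! hlt
  obtain ⟨T, hT, hcard⟩ := exists_subset_encard_eq (Order.add_one_le_of_lt hlt)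
  have hcard' : T.encard = ((n + 1 : ℕ) : ℕ∞) := by rw [hcard]; rfl
  have hfin : T.Finite := finite_of_encard_eq_coe hcard'
  have : Nonempty T := nonempty_coe_sort.2 <| nonempty_of_encard_ne_zero (by simp [hcard])
  obtain ⟨P, v, -, hP⟩ := exists_orbitLabelling hf hT hfin
  have h1 := hP.card_le h
  have h2 : T.ncard = n + 1 := by rw [ncard, hcard']; rfl
  rw [Nat.card_coe_set_eq] at h1
  omega

theorem isAsymptoticallyPeriodic_of_encard_eq (hf : Function.Injective f)
    (h : ContractsOnLevels n κ f ι) (hcard : (periodicOrbits f).encard = n) :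
    IsAsymptoticallyPeriodic f := by
  intro y
  have hn := h.lt y
  have hfin : (periodicOrbits f).Finite := finite_of_encard_eq_coe hcard
  have : Nonempty (periodicOrbits f) := nonempty_coe_sort.2 <|
    nonempty_of_encard_ne_zero (by rw [hcard]; exact_mod_cast Nat.ne_zero_of_lt hn)
  have : Finite (periodicOrbits f) := hfin
  obtain ⟨P, v, hPp, hP⟩ := exists_orbitLabelling hf subset_rfl hfin
  have hV : Nat.card (periodicOrbits f) = n := by
    rw [Nat.card_coe_set_eq, ncard, hcard]; rfl
  obtain ⟨m, p, hp, hpy⟩ := hP.exists_iterate_level_eq h hV y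
  exact ⟨_, ⟨p, hPp hp, rfl⟩,
    omegaLimitSet_eq_of_tendsto_dist (hPp hp) (h.tendsto_dist_iterate hpy)⟩

end

theorem theorem1p1 (n : ℕ) (f : Set.Ico (0 : ℝ) 1 → Set.Ico (0 : ℝ) 1)
    (hf : IsPiecewiseContraction n f) :
    (periodicOrbits f).encard ≤ n ∧
      ((periodicOrbits f).encard = n → IsAsymptoticallyPeriodic f) := by
  obtain ⟨κ, ι, h⟩ := hf.exists_contractsOnLevels
  exact ⟨encard_periodicOrbits_le hf.1 h, isAsymptoticallyPeriodic_of_encard_eq hf.1 h⟩
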